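/- **Theorem 5.2.** A finite ring $R$ is called a *Carmichael ring* if it is not a field and $a^{|R|}=a$ for all $a\in R$; an element of a commutative ring is *Carmichael* if the quotient by the ideal that it generates is a Carmichael ring. For a finite extension $K$ of $\mathbb{F}_q(t)$ let $\mathcal{O}_K$ be the integral closure of $\mathbb{F}_q[t]$ in $K$; a polynomial $g\in\mathbb{F}_q[t]$ is *Carmichael in $K$* if it is a Carmichael element of $\mathcal{O}_K$. The discriminant of $K$ is the ideal of $\mathbb{F}_q[t]$ generated by the discriminants of the $\mathbb{F}_q(t)$-bases of $K$ contained in $\mathcal{O}_K$. Let $q\equiv 2 \pmod 3$ be a prime power and let $g\in\mathbb{F}_q[t]$ be square-free of odd degree. Then $g$ has an irreducible factor of odd degree. Moreover, for every irreducible factor $P$ of $g$ of odd degree there are infinitely many pairwise non-isomorphic (over $\mathbb{F}_q(t)$) cubic extensions $K$ of $\mathbb{F}_q(t)$ such that 1. $K=\mathbb{F}_q(t)(\sqrt[3]{GH^2})$ for some distinct irreducible polynomials $G,H\in\mathbb{F}_q[t]$ that do not divide $g$ and satisfy $G\equiv H \pmod P$; 2. the discriminant of $K$ is coprime to $g$;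 3. some prime ideal of $\mathcal{O}_K$ above $P$ has residue degree $2$; 4. $g$ is not Carmichael in $K$. In particular, $g$ is not Carmichael in infinitely many cubic function fields over $\mathbb{F}_q(t)$ with discriminant coprime to $g$. -/

import Mathlib

open scoped Polynomial

/-- A Carmichael ring: a finite ring which is not a field and in which `a ^ |R| = a` for all `a`. -/
def IsCarmichaelRing (R : Type*) [Ring R] : Prop :=
  Finite R ∧ ¬ IsField R ∧ ∀ a : R, a ^ Nat.card R = a

/-- An ideal is a Carmichael ideal if the quotient by it is a Carmichael ring. -/
def IsCarmichaelIdeal {R : Type*} [CommRing R] (I : Ideal R) : Prop :=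
  IsCarmichaelRing (R ⧸ I)

/-- A Carmichael element is one that generates a Carmichael ideal. -/
def IsCarmichaelElement {R : Type*} [CommRing R] (a : R) : Prop :=
  IsCarmichaelIdeal (Ideal.span {a})

/-- The polynomial `g` is Carmichael in the function field `K`: as an element of the ring of
integers of `K` (the integral closure of `F[t]` in `K`) it is a Carmichael element. -/
def IsCarmichaelIn (F K : Type*) [Field F] [Field K] [Algebra F[X] K] (g : F[X]) : Prop :=
  IsCarmichaelElement (algebraMap F[X] (FunctionField.ringOfIntegers F K) g)

/-- The discriminant of `K` over `F(t)`, as an ideal of `F[t]`: it is generated by the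
discriminants of all the bases of `K` over `F(t)` that consist of elements of the ring of integers
of `K`. -/
noncomputable def functionFieldDiscr (F K : Type*) [Field F] [Field K] [Algebra F[X] K]
    [Algebra (RatFunc F) K] : Ideal F[X] :=
  Ideal.span {d : F[X] |
    ∃ b : Module.Basis (Fin (Module.finrank (RatFunc F) K)) (RatFunc F) K,
      (∀ i, b i ∈ FunctionField.ringOfIntegers F K) ∧
        algebraMap F[X] (RatFunc F) d = Algebra.discr (RatFunc F) b}

/-! Pigeonhole in the finite ring `F[X] ⧸ (P)` gives infinitely many monic irreducibles prime to `g`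
in one class mod `P`. For two of them, `G` and `H`, put `A = GH²` and `c = H`. Then `A ≡ c³` mod
`P`, so `X³ - A` factors there as `(X - c)(X² + cX + c²)`. A trace argument
(`not_dvd_gen_sub_algebraMap`) yields a prime `𝔭` above `P` containing the quadratic factor at `θ =
∛A`, without computing the ring of integers. Then `ω = θ/c` is a primitive cube root of unity mod
`𝔭`, and `ω ^ N = ω` forces `N ≡ 1` mod 3. Both local claims follow. The residue field of `𝔭` has
order `≡ 1`, whereas `q ^ deg P ≡ 2`, so the residue degree is even and at most 3. If `g` were
Carmichael, `N = q ^ (3 deg g) ≡ 2` would be such an exponent. Disjoint pairs `(G, H)` give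
non-isomorphic fields: an element of `K` that becomes a cube in `K(∛a)` is a cube times `1`, `a` or
`a²`, and multiplicities of `G` mod 3 exclude this. -/

/-! ### Irreducible polynomials and residue rings. -/

section Polynomials

theorem exists_irreducible_factor_odd_natDegree {F : Type*} [Field F] (g : F[X])
    (hdeg : Odd g.natDegree) : ∃ P : F[X], Irreducible P ∧ P ∣ g ∧ Odd P.natDegree := by
  induction g using UniqueFactorizationMonoid.induction_on_prime with
  | h₁ => simp at hdeg
  | h₂ x hx => simp [Polynomial.natDegree_eq_zero_of_isUnit hx] at hdeg
  | h₃ a p ha hp ih =>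
    rw [Polynomial.natDegree_mul hp.ne_zero ha, Nat.odd_add] at hdeg
    by_cases h : Odd p.natDegree
    · exact ⟨p, hp.irreducible, dvd_mul_right _ _, h⟩
    · have ha' : Odd a.natDegree := by
        rw [← Nat.not_even_iff_odd]
        exact fun h' => h (hdeg.2 h')
      obtain ⟨P, hP, hPa, hodd⟩ := ih ha'
      exact ⟨P, hP, hPa.mul_left _, hodd⟩

theorem infinite_monic_irreducible_not_dvd {F : Type*} [Field F] {g : F[X]} (hg : g ≠ 0) :
    {G : F[X] | G.Monic ∧ Irreducible G ∧ ¬ G ∣ g}.Infinite := by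
  intro hfin
  -- Euclid's argument on `N + 1`; the factor `X` keeps `N` nonconstant even if `g` is constant and
  -- the product empty.
  set N : F[X] := Polynomial.X * g * ∏ G ∈ hfin.toFinset, G with hN
  have hprod : ∏ G ∈ hfin.toFinset, G ≠ 0 := by
    rw [Finset.prod_ne_zero_iff]
    intro G hG
    rw [Set.Finite.mem_toFinset] at hG
    exact hG.2.1.ne_zero
  have hN0 : N.natDegree ≠ 0 := by
    rw [hN, Polynomial.natDegree_mul (mul_ne_zero Polynomial.X_ne_zero hg) hprod,
      Polynomial.natDegree_mul Polynomial.X_ne_zero hg, Polynomial.natDegree_X]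
    omega
  have hunit : ¬ IsUnit (N + Polynomial.C 1) := by
    intro h
    have := Polynomial.natDegree_eq_zero_of_isUnit h
    rw [Polynomial.natDegree_add_C] at this
    exact hN0 this
  obtain ⟨Q, hQm, hQ, hQN⟩ := Polynomial.exists_monic_irreducible_factor _ hunit
  have key : ¬ Q ∣ N := fun h => hQ.not_isUnit
    (isUnit_of_dvd_one (by simpa using (dvd_add_right h).1 hQN))
  by_cases hQg : Q ∣ g
  · exact key ((hQg.mul_left _).mul_right _)
  · exact key ((Finset.dvd_prod_of_mem _ (hfin.mem_toFinset.2 ⟨hQm, hQ, hQg⟩)).mul_left _)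

theorem natCard_quotient_span {F : Type*} [Field F] {g : F[X]} (hg : g ≠ 0) :
    Nat.card (F[X] ⧸ Ideal.span {g}) = Nat.card F ^ g.natDegree := by
  have : Module.Finite F (AdjoinRoot g) := (AdjoinRoot.powerBasis hg).finite
  have h := Module.natCard_eq_pow_finrank (K := F) (V := AdjoinRoot g)
  rw [(AdjoinRoot.powerBasis hg).finrank, AdjoinRoot.powerBasis_dim] at h
  -- `AdjoinRoot g` unfolds to the quotient.
  exact h

theorem finite_quotient_span {F : Type*} [Field F] [Finite F] {g : F[X]} (hg : g ≠ 0) :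
    Finite (F[X] ⧸ Ideal.span {g}) :=
  Nat.finite_of_card_ne_zero (by
    rw [natCard_quotient_span hg]
    exact pow_ne_zero _ Nat.card_pos.ne')

/-- Infinitely many distinct monic irreducible polynomials prime to `g` in one residue class. -/
theorem exists_injective_monic_irreducible_congr {F : Type*} [Field F] [Finite F] {g P : F[X]}
    (hg : g ≠ 0) (hP : P ≠ 0) :
    ∃ G : ℕ → F[X], Function.Injective G ∧
      (∀ n, (G n).Monic ∧ Irreducible (G n) ∧ ¬ G n ∣ g) ∧ ∀ m n, P ∣ G m - G n := by
  have := finite_quotient_span hP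
  have : Infinite {G : F[X] | G.Monic ∧ Irreducible G ∧ ¬ G ∣ g} :=
    (infinite_monic_irreducible_not_dvd hg).to_subtype
  obtain ⟨y, hy⟩ := Finite.exists_infinite_fiber
    (fun G : {G : F[X] | G.Monic ∧ Irreducible G ∧ ¬ G ∣ g} =>
      Ideal.Quotient.mk (Ideal.span {P}) G.1)
  let e := Infinite.natEmbedding (((fun G : {G : F[X] | G.Monic ∧ Irreducible G ∧ ¬ G ∣ g} =>
      Ideal.Quotient.mk (Ideal.span {P}) G.1)) ⁻¹' {y})
  refine ⟨fun n => (e n).1.1, fun m n h => e.injective (Subtype.ext (Subtype.ext h)),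
    fun n => (e n).1.2, fun m n => ?_⟩
  rw [← Ideal.mem_span_singleton, ← Ideal.Quotient.eq]
  exact (e m).2.trans (e n).2.symm

end Polynomials

/-! ### Cubes and multiplicities mod 3. -/

section Cubes

/-- The multiplicity of `p` is 1 mod 3 on the left and 0 mod 3 on the right. -/
theorem cube_mul_ne_cube_mul_of_prime {A : Type*} [CommRing A] [IsDomain A]
    [UniqueFactorizationMonoid A] {p c d u v : A}
    (hp : Prime p) (hc : ¬ p ∣ c) (hd : ¬ p ∣ d) (hu : u ≠ 0) :
    u ^ 3 * (p * c) ≠ v ^ 3 * d := by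
  intro h
  have fm {x : A} (hx : x ≠ 0) : FiniteMultiplicity p x :=
    FiniteMultiplicity.of_prime_left hp hx
  have hc0 : c ≠ 0 := by rintro rfl; simp at hc
  have hd0 : d ≠ 0 := by rintro rfl; simp at hd
  have hne : u ^ 3 * (p * c) ≠ 0 := mul_ne_zero (pow_ne_zero _ hu) (mul_ne_zero hp.ne_zero hc0)
  have hv : v ≠ 0 := by
    rintro rfl
    exact hne (by rw [h]; simp)
  have hl := multiplicity_mul hp (fm hne)
  have hr := multiplicity_mul hp (fm (h ▸ hne))
  rw [multiplicity_mul hp (fm (mul_ne_zero hp.ne_zero hc0)),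
    (fm hu).multiplicity_pow hp, multiplicity_self,
    multiplicity_eq_zero.2 hc, h] at hl
  rw [(fm hv).multiplicity_pow hp, multiplicity_eq_zero.2 hd] at hr
  omega

theorem algebraMap_ne_cube_mul_of_prime {A K : Type*} [CommRing A] [IsDomain A]
    [UniqueFactorizationMonoid A] [Field K] [Algebra A K] [IsFractionRing A K] {p c d : A}
    (hp : Prime p) (hc : ¬ p ∣ c) (hd : ¬ p ∣ d) (x : K) :
    algebraMap A K (p * c) ≠ x ^ 3 * algebraMap A K d := by
  intro h
  obtain ⟨v, u, hu, rfl⟩ := IsFractionRing.div_surjective (A := A) x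
  have hu0 : u ≠ 0 := nonZeroDivisors.ne_zero hu
  have hu' : algebraMap A K u ≠ 0 := by simpa using hu0
  refine cube_mul_ne_cube_mul_of_prime hp hc hd hu0 (v := v) (IsFractionRing.injective A K ?_)
  simp only [map_mul, map_pow] at h ⊢
  rw [h]
  field_simp

/-- A cube in a pure cubic extension, whose coordinates satisfy the relations saying that it
lies in the base field, comes from a monomial in the cube root. -/
theorem cube_eq_of_mul_relations {K : Type*} [Field K] {a b x y z : K} (ha : ∀ w, w ^ 3 ≠ a)
    (h0 : x ^ 3 + y ^ 3 * a + z ^ 3 * a ^ 2 + 6 * x * y * z * a = b)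
    (h1 : x ^ 2 * y + x * z ^ 2 * a + y ^ 2 * z * a = 0)
    (h2 : x ^ 2 * z + x * y ^ 2 + y * z ^ 2 * a = 0) :
    b = x ^ 3 ∨ b = y ^ 3 * a ∨ b = z ^ 3 * a ^ 2 := by
  have ha0 : a ≠ 0 := by
    rintro rfl
    exact ha 0 (by simp)
  by_cases hz : z = 0
  · subst hz
    have hxy : x ^ 2 * y = 0 := by linear_combination h1
    rcases mul_eq_zero.1 hxy with hx | hy
    · rw [pow_eq_zero_iff two_ne_zero] at hx
      subst hx
      exact Or.inr (Or.inl (by linear_combination -h0))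
    · subst hy
      exact Or.inl (by linear_combination -h0)
  -- Eliminating the other terms leaves this product; its second factor cannot vanish, since `a`
  -- would be `(y / z) ^ 3`.
  · have hx : x * (z ^ 3 * a - y ^ 3) = 0 := by linear_combination z * h1 - y * h2
    rcases mul_eq_zero.1 hx with hx | hx
    · subst hx
      have hyz : y * (z ^ 2 * a) = 0 := by linear_combination h2
      have hy : y = 0 := (mul_eq_zero.1 hyz).resolve_right
        (mul_ne_zero (pow_ne_zero _ hz) ha0)
      subst hy
      exact Or.inr (Or.inr (by linear_combination -h0))
    · refine absurd ?_ (ha (y / z))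
      field_simp
      linear_combination -hx

end Cubes

/-! ### Arithmetic of a pure cubic extension. -/

namespace PowerBasis

variable {K L : Type*} [Field K] [Field L] [Algebra K L] {a : K}

theorem dim_eq_three (pb : PowerBasis K L)
    (hmin : minpoly K pb.gen = Polynomial.X ^ 3 - Polynomial.C a) : pb.dim = 3 := by
  rw [← pb.natDegree_minpoly, hmin, Polynomial.natDegree_X_pow_sub_C]

theorem gen_cube (pb : PowerBasis K L)
    (hmin : minpoly K pb.gen = Polynomial.X ^ 3 - Polynomial.C a) :
    pb.gen ^ 3 = algebraMap K L a := by
  have h := minpoly.aeval K pb.gen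
  rw [hmin] at h
  simpa [sub_eq_zero] using h

theorem trace_gen_eq_zero (pb : PowerBasis K L)
    (hmin : minpoly K pb.gen = Polynomial.X ^ 3 - Polynomial.C a) :
    Algebra.trace K L pb.gen = 0 := by
  rw [pb.trace_gen_eq_nextCoeff_minpoly, hmin, Polynomial.nextCoeff,
    Polynomial.natDegree_X_pow_sub_C]
  simp [Polynomial.coeff_X_pow]

theorem norm_gen_eq (pb : PowerBasis K L)
    (hmin : minpoly K pb.gen = Polynomial.X ^ 3 - Polynomial.C a) :
    Algebra.norm K pb.gen = a := by
  rw [Algebra.PowerBasis.norm_gen_eq_coeff_zero_minpoly, hmin, pb.dim_eq_three hmin]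
  simp only [Polynomial.coeff_sub, Polynomial.coeff_X_pow, Polynomial.coeff_C_zero]
  norm_num

theorem discr_basis_eq [Algebra.IsSeparable K L] (pb : PowerBasis K L)
    (hmin : minpoly K pb.gen = Polynomial.X ^ 3 - Polynomial.C a) :
    Algebra.discr K pb.basis = -27 * a ^ 2 := by
  have := pb.finite
  have hfin : Module.finrank K L = 3 := by rw [pb.finrank, pb.dim_eq_three hmin]
  have haeval : Polynomial.aeval pb.gen (Polynomial.derivative (minpoly K pb.gen)) =
      algebraMap K L 3 * pb.gen ^ 2 := by
    rw [hmin]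
    simp only [Polynomial.derivative_sub, Polynomial.derivative_X_pow, Polynomial.derivative_C]
    simp [map_ofNat (algebraMap K L) 3]
  rw [Algebra.discr_powerBasis_eq_norm, haeval, map_mul, map_pow, Algebra.norm_algebraMap,
    pb.norm_gen_eq hmin, hfin]
  norm_num

theorem exists_eq_quadratic (pb : PowerBasis K L)
    (hmin : minpoly K pb.gen = Polynomial.X ^ 3 - Polynomial.C a) (β : L) :
    ∃ x y z : K, β = algebraMap K L x + algebraMap K L y * pb.gen +
      algebraMap K L z * pb.gen ^ 2 := by
  obtain ⟨f, hf, rfl⟩ := pb.exists_eq_aeval β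
  rw [pb.dim_eq_three hmin] at hf
  refine ⟨f.coeff 0, f.coeff 1, f.coeff 2, ?_⟩
  rw [Polynomial.aeval_eq_sum_range' hf]
  simp [Finset.sum_range_succ, Algebra.smul_def]

theorem quadratic_eq_zero (pb : PowerBasis K L)
    (hmin : minpoly K pb.gen = Polynomial.X ^ 3 - Polynomial.C a) {x y z : K}
    (h : algebraMap K L x + algebraMap K L y * pb.gen + algebraMap K L z * pb.gen ^ 2 = 0) :
    x = 0 ∧ y = 0 ∧ z = 0 := by
  set f : K[X] := Polynomial.C x + Polynomial.C y * Polynomial.X +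
    Polynomial.C z * Polynomial.X ^ 2 with hf
  have hdeg : f.natDegree ≤ 2 := by
    rw [hf]
    compute_degree
  have h0 : f = 0 := by
    by_contra hne
    have := pb.dim_le_natDegree_of_root hne (by simpa [hf] using h)
    rw [pb.dim_eq_three hmin] at this
    omega
  refine ⟨?_, ?_, ?_⟩
  · simpa [hf] using congrArg (Polynomial.coeff · 0) h0
  · simpa [hf, Polynomial.coeff_X, Polynomial.coeff_C] using congrArg (Polynomial.coeff · 1) h0
  · simpa [hf, Polynomial.coeff_X, Polynomial.coeff_C] using congrArg (Polynomial.coeff · 2) h0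

/-- The elements of `K` that become cubes in the pure cubic extension `K(∛a)`. -/
theorem eq_cube_mul_of_cube_eq (pb : PowerBasis K L)
    (hmin : minpoly K pb.gen = Polynomial.X ^ 3 - Polynomial.C a) (h3 : (3 : K) ≠ 0)
    (ha : ∀ w, w ^ 3 ≠ a) {b : K} {β : L} (hβ : β ^ 3 = algebraMap K L b) :
    ∃ w, b = w ^ 3 ∨ b = w ^ 3 * a ∨ b = w ^ 3 * a ^ 2 := by
  obtain ⟨x, y, z, rfl⟩ := pb.exists_eq_quadratic hmin β
  have hg := pb.gen_cube hmin
  -- Expansion of `β ^ 3 - b` in the basis `1, θ, θ²`. The factor 3 in the last two coordinates is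
  -- why `h3` is needed.
  have key : algebraMap K L (x ^ 3 + y ^ 3 * a + z ^ 3 * a ^ 2 + 6 * x * y * z * a - b) +
      algebraMap K L (3 * (x ^ 2 * y + x * z ^ 2 * a + y ^ 2 * z * a)) * pb.gen +
      algebraMap K L (3 * (x ^ 2 * z + x * y ^ 2 + y * z ^ 2 * a)) * pb.gen ^ 2 = 0 := by
    simp only [map_add, map_sub, map_mul, map_pow, map_ofNat] at hβ ⊢
    rw [← hg]
    linear_combination hβ
  obtain ⟨h0, h1, h2⟩ := pb.quadratic_eq_zero hmin key
  rcases cube_eq_of_mul_relations ha (sub_eq_zero.1 h0) ((mul_eq_zero.1 h1).resolve_left h3)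
    ((mul_eq_zero.1 h2).resolve_left h3) with h | h | h
  exacts [⟨x, Or.inl h⟩, ⟨y, Or.inr (Or.inl h)⟩, ⟨z, Or.inr (Or.inr h)⟩]

end PowerBasis

/-! ### Residues mod 3 and sizes of quotients. -/

section Residues

theorem pow_mod_three_of_odd {q n : ℕ} (hq : q ≡ 2 [MOD 3]) (hn : Odd n) :
    q ^ n ≡ 2 [MOD 3] := by
  obtain ⟨k, rfl⟩ := hn
  calc q ^ (2 * k + 1) ≡ 2 ^ (2 * k + 1) [MOD 3] := hq.pow _
    _ = 4 ^ k * 2 := by rw [pow_succ, pow_mul]; norm_num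
    _ ≡ 1 ^ k * 2 [MOD 3] := (Nat.ModEq.pow k (show 4 ≡ 1 [MOD 3] from rfl)).mul_right 2
    _ = 2 := by simp

theorem three_ne_zero_of_natCard {F : Type*} [Field F] [Finite F]
    (hq : Nat.card F ≡ 2 [MOD 3]) : (3 : F) ≠ 0 := by
  intro h
  have h3 : addOrderOf (1 : F) = 3 := by
    have : Fact (Nat.Prime 3) := ⟨Nat.prime_three⟩
    exact addOrderOf_eq_prime (by simpa using h) one_ne_zero
  have := addOrderOf_dvd_natCard (1 : F)
  rw [h3] at this
  unfold Nat.ModEq at hq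
  omega

/-- `ω` has order exactly 3, because `ω = 1` would give `3 = 0`. -/
theorem mod_three_eq_one_of_pow_eq {k : Type*} [Field k] (h3 : (3 : k) ≠ 0) {ω : k}
    (hω : ω ^ 2 + ω + 1 = 0) {N : ℕ} (hN : ω ^ N = ω) : N % 3 = 1 := by
  have hcube : ω ^ 3 = 1 := by linear_combination (ω - 1) * hω
  have h1 : ω ≠ 1 := by
    rintro rfl
    exact h3 (by linear_combination hω)
  have h0 : ω ≠ 0 := by
    rintro rfl
    simp at hω
  rw [← Nat.div_add_mod N 3, pow_add, pow_mul, hcube, one_pow, one_mul] at hN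
  have hlt := Nat.mod_lt N (show 3 > 0 by norm_num)
  interval_cases h : N % 3
  · exact absurd (by simpa using hN.symm) h1
  · rfl
  · exact absurd (mul_left_cancel₀ h0 (by linear_combination hN)) h1

/-- The quotient is the base change of `S` to `R ⧸ I`, hence free of the same rank. This counts
residues modulo `g` without factoring it. -/
theorem natCard_quotient_map {R S : Type*} [CommRing R] [Nontrivial R] [CommRing S] [Algebra R S]
    [Module.Free R S] [Module.Finite R S] (I : Ideal R) :
    Nat.card (S ⧸ I.map (algebraMap R S)) = Nat.card (R ⧸ I) ^ Module.finrank R S := by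
  let e := Algebra.TensorProduct.quotIdealMapEquivTensorQuot S I
  let b := (Module.finBasis R S).baseChange (R ⧸ I)
  rw [Nat.card_congr (e.toEquiv.trans
    ((TensorProduct.comm R S (R ⧸ I)).toEquiv.trans b.equivFun.toEquiv))]
  simp [Nat.card_fun]

end Residues

/-! ### Behaviour of primes, and the discriminant. -/

section Splitting

variable {F L : Type*} [Field F] [Field L] [Algebra F[X] L]
  [Algebra (RatFunc F) L] [IsScalarTower F[X] (RatFunc F) L]

/-- The generator has trace zero, so `θ - c` has trace `-3c`, while a multiple of `P` among integral
elements has trace divisible by `P`. -/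
theorem not_dvd_gen_sub_algebraMap [FunctionField F L] {A P c : F[X]}
    (pb : PowerBasis (RatFunc F) L)
    (hmin : minpoly (RatFunc F) pb.gen =
      Polynomial.X ^ 3 - Polynomial.C (algebraMap F[X] (RatFunc F) A))
    (h3c : ¬ P ∣ 3 * c) (θ : FunctionField.ringOfIntegers F L) (hθ : (θ : L) = pb.gen) :
    ¬ algebraMap F[X] (FunctionField.ringOfIntegers F L) P ∣
      θ - algebraMap F[X] (FunctionField.ringOfIntegers F L) c := by
  rintro ⟨s, hs⟩
  have hs' : pb.gen - algebraMap F[X] L c = algebraMap F[X] L P * s := by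
    rw [← hθ]
    exact congrArg Subtype.val hs
  obtain ⟨u, hu⟩ := IsIntegrallyClosed.isIntegral_iff.1
    (Algebra.isIntegral_trace (L := RatFunc F) s.2)
  have htr := congrArg (Algebra.trace (RatFunc F) L) hs'
  rw [map_sub, pb.trace_gen_eq_zero hmin, IsScalarTower.algebraMap_apply F[X] (RatFunc F) L,
    IsScalarTower.algebraMap_apply F[X] (RatFunc F) L P, ← Algebra.smul_def, map_smul,
    Algebra.trace_algebraMap, pb.finrank, pb.dim_eq_three hmin, ← hu, smul_eq_mul,
    ← map_mul, nsmul_eq_mul, ← map_natCast (algebraMap F[X] (RatFunc F)), ← map_mul,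
    zero_sub, ← map_neg] at htr
  have := IsFractionRing.injective F[X] (RatFunc F) htr
  exact h3c ⟨-u, by push_cast at this; linear_combination -this⟩

/-- If `P ∤ 3c` and `P ∣ A - c³`, some prime above `P` contains `θ² + cθ + c²`, where `θ³ = A`. -/
theorem exists_maximal_liesOver_quadratic_mem [FunctionField F L]
    {A P c : F[X]} (pb : PowerBasis (RatFunc F) L)
    (hmin : minpoly (RatFunc F) pb.gen =
      Polynomial.X ^ 3 - Polynomial.C (algebraMap F[X] (RatFunc F) A))
    (hP : Irreducible P) (hA : P ∣ A - c ^ 3) (h3c : ¬ P ∣ 3 * c) :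
    ∃ (θ : FunctionField.ringOfIntegers F L) (𝔭 : Ideal (FunctionField.ringOfIntegers F L)),
      𝔭.IsMaximal ∧ 𝔭.LiesOver (Ideal.span {P}) ∧
      θ ^ 2 + algebraMap F[X] (FunctionField.ringOfIntegers F L) c * θ +
        algebraMap F[X] (FunctionField.ringOfIntegers F L) c ^ 2 ∈ 𝔭 := by
  set S := FunctionField.ringOfIntegers F L
  have hgen : pb.gen ^ 3 = algebraMap F[X] L A := by
    rw [pb.gen_cube hmin, ← IsScalarTower.algebraMap_apply]
  have hint : IsIntegral F[X] pb.gen :=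
    .of_pow (n := 3) (by norm_num) (hgen ▸ isIntegral_algebraMap)
  let θ : S := ⟨pb.gen, hint⟩
  have hθ3 : θ ^ 3 = algebraMap F[X] S A := Subtype.ext hgen
  set y : S := θ ^ 2 + algebraMap F[X] S c * θ + algebraMap F[X] S c ^ 2 with hy
  -- Since `(θ - c)y = A - c³` is a multiple of `P`, a relation `uP + vy = 1` times `θ - c` would
  -- make `P` divide `θ - c`.
  have hne : Ideal.span {algebraMap F[X] S P, y} ≠ ⊤ := by
    intro htop
    rw [Ideal.eq_top_iff_one, Ideal.mem_span_pair] at htop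
    obtain ⟨u, v, huv⟩ := htop
    obtain ⟨w, hw⟩ := hA
    have hw' := congrArg (algebraMap F[X] S) hw
    rw [map_sub, map_pow, map_mul, ← hθ3] at hw'
    refine not_dvd_gen_sub_algebraMap pb hmin h3c θ rfl
      ⟨(θ - algebraMap F[X] S c) * u + v * algebraMap F[X] S w, ?_⟩
    linear_combination (-(θ - algebraMap F[X] S c)) * huv + v * hw' +
      v * (θ - algebraMap F[X] S c) * hy
  obtain ⟨𝔭, hmax, hle⟩ := Ideal.exists_le_maximal _ hne
  refine ⟨θ, 𝔭, hmax, ⟨?_⟩, hle (Ideal.subset_span (Set.mem_insert_of_mem _ rfl))⟩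
  refine (PrincipalIdealRing.isMaximal_of_irreducible hP).eq_of_le
    (Ideal.comap_isPrime _ 𝔭).ne_top ?_
  rw [Ideal.span_singleton_le_iff_mem]
  exact hle (Ideal.subset_span (by simp))

theorem algebraMap_mem_of_liesOver_span {R S : Type*} [CommRing R] [CommRing S] [Algebra R S]
    {P g : R} (hPg : P ∣ g) (𝔭 : Ideal S) [𝔭.LiesOver (Ideal.span {P})] :
    algebraMap R S g ∈ 𝔭 := by
  rw [← Ideal.mem_comap, ← Ideal.under_def, ← Ideal.over_def 𝔭 (Ideal.span {P})]
  exact Ideal.mem_span_singleton.2 hPg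

/-- A prime above `P` that contains `θ² + cθ + c²` has a primitive cube root of unity in its
residue field. -/
theorem mod_three_eq_one_of_pow_sub_mem {S : Type*} [CommRing S] [Algebra F[X] S] {P c : F[X]}
    (h3 : (3 : F) ≠ 0) (hP : Irreducible P) (hc : ¬ P ∣ c) {θ : S} {𝔭 : Ideal S} [𝔭.IsMaximal]
    [𝔭.LiesOver (Ideal.span {P})]
    (hy : θ ^ 2 + algebraMap F[X] S c * θ + algebraMap F[X] S c ^ 2 ∈ 𝔭) {N : ℕ}
    (hN : ∀ a : S, a ^ N - a ∈ 𝔭) : N % 3 = 1 := by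
  let := Ideal.Quotient.field 𝔭
  have hPmem : algebraMap F[X] S P ∈ 𝔭 := algebraMap_mem_of_liesOver_span dvd_rfl 𝔭
  obtain ⟨u, v, huv⟩ := (hP.coprime_iff_not_dvd.2 hc)
  have huv' : algebraMap F[X] S v * algebraMap F[X] S c - 1 ∈ 𝔭 := by
    have : algebraMap F[X] S v * algebraMap F[X] S c - 1 =
        -algebraMap F[X] S u * algebraMap F[X] S P := by
      rw [← map_one (algebraMap F[X] S), ← huv]
      simp
    rw [this]
    exact 𝔭.mul_mem_left _ hPmem
  rw [← Ideal.Quotient.eq_zero_iff_mem] at hy huv'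
  set q := Ideal.Quotient.mk 𝔭
  simp only [map_add, map_sub, map_mul, map_pow, map_one] at hy huv'
  -- `v` inverts `c` modulo `𝔭`, so this `ω` is `θ / c`.
  refine mod_three_eq_one_of_pow_eq (k := S ⧸ 𝔭) (ω := q (algebraMap F[X] S v * θ)) ?_ ?_ ?_
  · have h := (RingHom.injective (q.comp ((algebraMap F[X] S).comp Polynomial.C))).ne h3
    simpa only [map_zero, map_ofNat] using h
  · rw [map_mul]
    linear_combination q (algebraMap F[X] S v) ^ 2 * hy -
      (q (algebraMap F[X] S v) * q θ + q (algebraMap F[X] S v) * q (algebraMap F[X] S c) + 1) * huv'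
  · rw [← map_pow, ← sub_eq_zero, ← map_sub, Ideal.Quotient.eq_zero_iff_mem]
    exact hN _

theorem natCard_ringOfIntegers_quotient_span [FunctionField F L]
    [Algebra.IsSeparable (RatFunc F) L] {g : F[X]} (hg : g ≠ 0) :
    Nat.card (FunctionField.ringOfIntegers F L ⧸
      Ideal.span {algebraMap F[X] (FunctionField.ringOfIntegers F L) g}) =
      (Nat.card F ^ g.natDegree) ^ Module.finrank (RatFunc F) L := by
  have : Module.Finite F[X] (FunctionField.ringOfIntegers F L) :=
    IsIntegralClosure.finite F[X] (RatFunc F) L _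
  have : Module.IsTorsionFree F[X] L :=
    Module.IsTorsionFree.trans_faithfulSMul F[X] (RatFunc F) L
  have : Module.Free F[X] (FunctionField.ringOfIntegers F L) :=
    IsIntegralClosure.module_free F[X] (RatFunc F) L _
  rw [← natCard_quotient_span hg,
    ← IsIntegralClosure.rank F[X] (RatFunc F) L (FunctionField.ringOfIntegers F L),
    ← natCard_quotient_map, Ideal.map_span, Set.image_singleton]

/-- With `Q = |F[X] ⧸ (P)| ≡ 2` mod 3, a residue field of order `Q ^ f ≡ 1` forces `f` even; being a
quotient of a ring of order `Q ^ 3` gives `f ≤ 3`. -/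
theorem inertiaDeg_eq_two_of_quadratic_mem [Finite F] {S : Type*} [CommRing S] [Algebra F[X] S]
    (hq : Nat.card F ≡ 2 [MOD 3]) {P c : F[X]}
    (hP : Irreducible P) (hodd : Odd P.natDegree) (hc : ¬ P ∣ c)
    (hcardS : Nat.card (S ⧸ Ideal.span {algebraMap F[X] S P}) = (Nat.card F ^ P.natDegree) ^ 3)
    {θ : S} {𝔭 : Ideal S} [𝔭.IsMaximal] [𝔭.LiesOver (Ideal.span {P})]
    (hy : θ ^ 2 + algebraMap F[X] S c * θ + algebraMap F[X] S c ^ 2 ∈ 𝔭) :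
    𝔭.inertiaDeg F[X] = 2 := by
  have hPmax : (Ideal.span {P}).IsMaximal := PrincipalIdealRing.isMaximal_of_irreducible hP
  let := Ideal.Quotient.field (Ideal.span {P})
  let := Ideal.Quotient.field 𝔭
  have hPmem : algebraMap F[X] S P ∈ 𝔭 := algebraMap_mem_of_liesOver_span dvd_rfl 𝔭
  have hcardP := natCard_quotient_span hP.ne_zero
  rw [← hcardP] at hcardS
  set Q := Nat.card (F[X] ⧸ Ideal.span {P}) with hQ
  have hQ3 : Q ≡ 2 [MOD 3] := by
    rw [hcardP]
    exact pow_mod_three_of_odd hq hodd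
  have : Finite (F[X] ⧸ Ideal.span {P}) := finite_quotient_span hP.ne_zero
  have hQ1 : 1 < Q := Finite.one_lt_card
  have : Finite (S ⧸ Ideal.span {algebraMap F[X] S P}) :=
    Nat.finite_of_card_ne_zero (by rw [hcardS]; positivity)
  have hle : Ideal.span {algebraMap F[X] S P} ≤ 𝔭 := by
    rwa [Ideal.span_singleton_le_iff_mem]
  have hsurj := Ideal.Quotient.factor_surjective hle
  have : Finite (S ⧸ 𝔭) := Finite.of_surjective _ hsurj
  have hcard_le := Nat.card_le_card_of_surjective _ hsurj
  have : Module.Finite (F[X] ⧸ Ideal.span {P}) (S ⧸ 𝔭) := Module.Finite.of_finite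
  have hcard := Module.natCard_eq_pow_finrank (K := F[X] ⧸ Ideal.span {P}) (V := S ⧸ 𝔭)
  rw [Ideal.inertiaDeg_eq_of_isMaximal (Ideal.span {P}) 𝔭]
  have hpos : 0 < Module.finrank (F[X] ⧸ Ideal.span {P}) (S ⧸ 𝔭) := Module.finrank_pos
  set f := Module.finrank (F[X] ⧸ Ideal.span {P}) (S ⧸ 𝔭)
  rw [hcard, hcardS, Nat.pow_le_pow_iff_right hQ1] at hcard_le
  have hmod : Nat.card (S ⧸ 𝔭) % 3 = 1 := by
    refine mod_three_eq_one_of_pow_sub_mem (three_ne_zero_of_natCard hq) hP hc hy fun a => ?_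
    have := Fintype.ofFinite (S ⧸ 𝔭)
    rw [← Ideal.Quotient.eq_zero_iff_mem, map_sub, map_pow, Nat.card_eq_fintype_card,
      FiniteField.pow_card, sub_self]
  have heven : Even f := by
    rw [← Nat.not_odd_iff_even]
    intro hf
    have := pow_mod_three_of_odd hQ3 hf
    rw [← hQ, hcard] at *
    unfold Nat.ModEq at this
    omega
  obtain ⟨k, hk⟩ := heven
  omega

theorem not_isCarmichaelIn_of_quadratic_mem [Finite F] [FunctionField F L]
    [Algebra.IsSeparable (RatFunc F) L] (hq : Nat.card F ≡ 2 [MOD 3])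
    (hfin : Module.finrank (RatFunc F) L = 3) {g P c : F[X]} (hg : Odd g.natDegree)
    (hP : Irreducible P) (hPg : P ∣ g) (hc : ¬ P ∣ c)
    {θ : FunctionField.ringOfIntegers F L} {𝔭 : Ideal (FunctionField.ringOfIntegers F L)}
    [𝔭.IsMaximal] [𝔭.LiesOver (Ideal.span {P})]
    (hy : θ ^ 2 + algebraMap F[X] (FunctionField.ringOfIntegers F L) c * θ +
        algebraMap F[X] (FunctionField.ringOfIntegers F L) c ^ 2 ∈ 𝔭) :
    ¬ IsCarmichaelIn F L g := by
  rintro ⟨-, -, h⟩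
  have hg0 : g ≠ 0 := by
    rintro rfl
    simp at hg
  rw [natCard_ringOfIntegers_quotient_span hg0, hfin] at h
  have hgmem : algebraMap F[X] (FunctionField.ringOfIntegers F L) g ∈ 𝔭 :=
    algebraMap_mem_of_liesOver_span hPg 𝔭
  have h1 := mod_three_eq_one_of_pow_sub_mem (three_ne_zero_of_natCard hq) hP hc hy
    (N := (Nat.card F ^ g.natDegree) ^ 3) fun a => by
      have ha := h (Ideal.Quotient.mk _ a)
      rw [← map_pow, Ideal.Quotient.eq] at ha
      exact (Ideal.span_singleton_le_iff_mem _).2 hgmem ha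
  have h2 := pow_mod_three_of_odd (pow_mod_three_of_odd hq hg) (show Odd 3 by decide)
  unfold Nat.ModEq at h2
  omega

/-- The powers of the cube root form an integral basis of the field, not necessarily of its ring of
integers. Their discriminant `-27A²` lies in the discriminant ideal, which suffices as 27 is a unit.
-/
theorem isCoprime_functionFieldDiscr [Algebra.IsSeparable (RatFunc F) L] {A g : F[X]}
    (h3 : (3 : F) ≠ 0) (pb : PowerBasis (RatFunc F) L)
    (hmin : minpoly (RatFunc F) pb.gen =
      Polynomial.X ^ 3 - Polynomial.C (algebraMap F[X] (RatFunc F) A))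
    (hA : IsCoprime A g) : IsCoprime (functionFieldDiscr F L) (Ideal.span {g}) := by
  have hgen : pb.gen ^ 3 = algebraMap F[X] L A := by
    rw [pb.gen_cube hmin, ← IsScalarTower.algebraMap_apply]
  have hint : IsIntegral F[X] pb.gen :=
    .of_pow (n := 3) (by norm_num) (hgen ▸ isIntegral_algebraMap)
  have hmem : (-27 * A ^ 2 : F[X]) ∈ functionFieldDiscr F L := by
    refine Ideal.subset_span ⟨pb.basis.reindex (finCongr pb.finrank.symm), fun i => ?_, ?_⟩
    · rw [Module.Basis.reindex_apply, pb.basis_eq_pow]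
      exact pow_mem (show pb.gen ∈ FunctionField.ringOfIntegers F L from hint) _
    · rw [Module.Basis.coe_reindex, Algebra.discr_reindex, pb.discr_basis_eq hmin, map_mul,
        map_pow, map_neg, map_ofNat]
  have h27 : IsUnit (-27 : F[X]) := by
    have h27' : (-27 : F) ≠ 0 := by
      rw [show (-27 : F) = -3 ^ 3 by norm_num]
      exact neg_ne_zero.2 (pow_ne_zero _ h3)
    have := Polynomial.isUnit_C.2 h27'.isUnit
    rwa [map_neg, map_ofNat] at this
  have hcop : IsCoprime (-27 * A ^ 2) g := (isCoprime_mul_unit_left_left h27 _ _).2 hA.pow_left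
  rw [Ideal.isCoprime_iff_sup_eq, eq_top_iff,
    ← Ideal.isCoprime_iff_sup_eq.1 ((Ideal.isCoprime_span_singleton_iff _ _).2 hcop)]
  exact sup_le_sup_right ((Ideal.span_singleton_le_iff_mem _).2 hmem) _

end Splitting

/-! ### Adjoining a cube root. -/

section PureCubic

open IntermediateField

variable {K E : Type*} [Field K] [Field E] [Algebra K E]

theorem minpoly_eq_X_pow_three_sub_C {a : K} (ha : ∀ w, w ^ 3 ≠ a) {θ : E}
    (hθ : θ ^ 3 = algebraMap K E a) :
    minpoly K θ = Polynomial.X ^ 3 - Polynomial.C a :=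
  (minpoly.eq_of_irreducible_of_monic
    (X_pow_sub_C_irreducible_of_prime Nat.prime_three ha) (by simp [hθ])
    (Polynomial.monic_X_pow_sub_C a three_ne_zero)).symm

theorem exists_powerBasis_adjoin_cubeRoot {a : K} (ha : ∀ w, w ^ 3 ≠ a) {θ : E}
    (hθ : θ ^ 3 = algebraMap K E a) :
    ∃ pb : PowerBasis K K⟮θ⟯, minpoly K pb.gen = Polynomial.X ^ 3 - Polynomial.C a := by
  have hint : IsIntegral K θ := .of_pow (n := 3) (by norm_num) (hθ ▸ isIntegral_algebraMap)
  refine ⟨adjoin.powerBasis hint, ?_⟩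
  rw [adjoin.powerBasis_gen, minpoly_gen, minpoly_eq_X_pow_three_sub_C ha hθ]

/-- Separability makes the ring of integers finite and free over `F[X]`, as the residue count
requires. -/
theorem isSeparable_adjoin_cubeRoot {a : K} (h3 : (3 : K) ≠ 0) (ha : ∀ w, w ^ 3 ≠ a) {θ : E}
    (hθ : θ ^ 3 = algebraMap K E a) : Algebra.IsSeparable K K⟮θ⟯ := by
  rw [isSeparable_adjoin_simple_iff_isSeparable, IsSeparable, minpoly_eq_X_pow_three_sub_C ha hθ]
  refine Polynomial.separable_X_pow_sub_C a (by exact_mod_cast h3) ?_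
  rintro rfl
  exact ha 0 (by simp)

end PureCubic

/-! ### Telling pure cubic fields apart. -/

section Irreducibles

variable {F : Type*} [Field F]

theorem not_dvd_of_monic_irreducible {p r : F[X]} (hp : p.Monic) (hpi : Irreducible p)
    (hr : r.Monic) (hri : Irreducible r) (hne : p ≠ r) : ¬ p ∣ r := fun h =>
  hne (Polynomial.eq_of_monic_of_associated hp hr (hpi.associated_of_dvd hri h))

theorem cube_ne_algebraMap_mul_sq {G H : F[X]} (hG : Irreducible G) (hGH : ¬ G ∣ H)
    (w : RatFunc F) : w ^ 3 ≠ algebraMap F[X] (RatFunc F) (G * H ^ 2) := fun h =>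
  algebraMap_ne_cube_mul_of_prime hG.prime (fun hd => hGH (hG.prime.dvd_of_dvd_pow hd))
    hG.prime.not_dvd_one w (by rw [← h]; simp)

open IntermediateField in
/-- Pure cubic fields with radicands `G₁H₁²` and `G₂H₂²` are not isomorphic if the prime `G₁`
does not divide `H₁G₂H₂`. -/
theorem isEmpty_algEquiv_adjoin_cubeRoot {E : Type*} [Field E] [Algebra (RatFunc F) E]
    (h3 : (3 : F) ≠ 0) {G₁ H₁ G₂ H₂ : F[X]} (hG₁ : Irreducible G₁) (hG₂ : Irreducible G₂)
    (h₁ : ¬ G₁ ∣ H₁) (h₂ : ¬ G₂ ∣ H₂) (hGG : ¬ G₁ ∣ G₂) (hGH : ¬ G₁ ∣ H₂) {θ₁ θ₂ : E}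
    (hθ₁ : θ₁ ^ 3 = algebraMap (RatFunc F) E (algebraMap F[X] (RatFunc F) (G₁ * H₁ ^ 2)))
    (hθ₂ : θ₂ ^ 3 = algebraMap (RatFunc F) E (algebraMap F[X] (RatFunc F) (G₂ * H₂ ^ 2))) :
    IsEmpty ((RatFunc F)⟮θ₁⟯ ≃ₐ[RatFunc F] (RatFunc F)⟮θ₂⟯) := by
  refine ⟨fun e => ?_⟩
  have h3' : (3 : RatFunc F) ≠ 0 := by
    simpa only [map_zero, map_ofNat] using (algebraMap F (RatFunc F)).injective.ne h3
  obtain ⟨pb₁, hpb₁⟩ := exists_powerBasis_adjoin_cubeRoot (cube_ne_algebraMap_mul_sq hG₁ h₁) hθ₁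
  obtain ⟨pb₂, hpb₂⟩ := exists_powerBasis_adjoin_cubeRoot (cube_ne_algebraMap_mul_sq hG₂ h₂) hθ₂
  have hβ : e pb₁.gen ^ 3 =
      algebraMap (RatFunc F) _ (algebraMap F[X] (RatFunc F) (G₁ * H₁ ^ 2)) := by
    rw [← map_pow, pb₁.gen_cube hpb₁, e.commutes]
  have hp := hG₁.prime
  have hc : ¬ G₁ ∣ H₁ ^ 2 := fun h => h₁ (hp.dvd_of_dvd_pow h)
  have hd : ¬ G₁ ∣ G₂ * H₂ ^ 2 := fun h =>
    (hp.dvd_or_dvd h).elim hGG fun h => hGH (hp.dvd_of_dvd_pow h)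
  -- `G₁` divides `G₁ * H₁ ^ 2` exactly once, but its multiplicity in each of the three alternatives
  -- is 0 mod 3.
  obtain ⟨w, h | h | h⟩ := pb₂.eq_cube_mul_of_cube_eq hpb₂ h3' (cube_ne_algebraMap_mul_sq hG₂ h₂) hβ
  · exact algebraMap_ne_cube_mul_of_prime hp hc hp.not_dvd_one w (by simpa using h)
  · exact algebraMap_ne_cube_mul_of_prime hp hc hd w h
  · exact algebraMap_ne_cube_mul_of_prime hp hc (fun hd' => hd (hp.dvd_of_dvd_pow hd')) w
      (by rw [h, map_pow])

end Irreducibles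

theorem theorem5p2 {F : Type*} [Field F] [Finite F] (hq : Nat.card F ≡ 2 [MOD 3])
    (g : F[X]) (hg : Squarefree g) (hdeg : Odd g.natDegree) :
    (∃ P : F[X], Irreducible P ∧ P ∣ g ∧ Odd P.natDegree) ∧
    ∀ P : F[X], Irreducible P → P ∣ g → Odd P.natDegree →
      ∃ K : ℕ → IntermediateField (RatFunc F) (AlgebraicClosure (RatFunc F)),
        -- the fields are pairwise non-isomorphic over `F(t)`
        Pairwise (fun m n => IsEmpty (K m ≃ₐ[RatFunc F] K n)) ∧
        ∀ n,
          -- `K n` is a cubic extension of `F(t)`, generated by a cube root of `G * H ^ 2`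
          Module.finrank (RatFunc F) (K n) = 3 ∧
          (∃ (G H : F[X]) (θ : AlgebraicClosure (RatFunc F)),
            Irreducible G ∧ Irreducible H ∧ G ≠ H ∧ ¬ G ∣ g ∧ ¬ H ∣ g ∧ P ∣ G - H ∧
            θ ^ 3 = algebraMap F[X] (AlgebraicClosure (RatFunc F)) (G * H ^ 2) ∧
            K n = IntermediateField.adjoin (RatFunc F) {θ}) ∧
          -- its discriminant is coprime to `g`
          IsCoprime (functionFieldDiscr F (K n)) (Ideal.span {g}) ∧
          -- some prime of `K n` above `P` has residue degree two
          (∃ 𝔭 : Ideal (FunctionField.ringOfIntegers F (K n)),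
            𝔭.IsPrime ∧ 𝔭.LiesOver (Ideal.span {P}) ∧
              𝔭.inertiaDeg F[X] = 2) ∧
          ¬ IsCarmichaelIn F (K n) g := by
  refine ⟨exists_irreducible_factor_odd_natDegree g hdeg, fun P hP hPg hPodd => ?_⟩
  have h3 : (3 : F) ≠ 0 := three_ne_zero_of_natCard hq
  have h3' : (3 : RatFunc F) ≠ 0 := by
    simpa only [map_zero, map_ofNat] using (algebraMap F (RatFunc F)).injective.ne h3
  have h3P : ¬ P ∣ 3 := fun h => hP.not_isUnit (isUnit_of_dvd_unit h (by
    simpa only [map_ofNat] using Polynomial.isUnit_C.2 h3.isUnit))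
  obtain ⟨p, hinj, hp, hcongr⟩ := exists_injective_monic_irreducible_congr hg.ne_zero hP.ne_zero
  have hndvd {i j : ℕ} (hij : i ≠ j) : ¬ p i ∣ p j :=
    not_dvd_of_monic_irreducible (hp i).1 (hp i).2.1 (hp j).1 (hp j).2.1 (hinj.ne hij)
  have hPp (i : ℕ) : ¬ P ∣ p i := fun h =>
    (hp i).2.2 (((hP.associated_of_dvd (hp i).2.1 h).symm.dvd).trans hPg)
  -- The pairs `(p (2n), p (2n+1))` are disjoint for different `n`, as the non-isomorphism needs.
  have hroot (n : ℕ) : ∃ θ : AlgebraicClosure (RatFunc F), θ ^ 3 =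
      algebraMap (RatFunc F) (AlgebraicClosure (RatFunc F))
        (algebraMap F[X] (RatFunc F) (p (2 * n) * p (2 * n + 1) ^ 2)) :=
    IsAlgClosed.exists_pow_nat_eq _ (by norm_num)
  choose θ hθ using hroot
  refine ⟨fun n => IntermediateField.adjoin (RatFunc F) {θ n}, fun m n hmn => ?_, fun n => ?_⟩
  · exact isEmpty_algEquiv_adjoin_cubeRoot h3 (hp _).2.1 (hp _).2.1 (hndvd (by omega))
      (hndvd (by omega)) (hndvd (by omega)) (hndvd (by omega)) (hθ m) (hθ n)
  · have hcube := cube_ne_algebraMap_mul_sq (hp (2 * n)).2.1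
      (hndvd (show 2 * n ≠ 2 * n + 1 by omega))
    obtain ⟨pb, hmin⟩ := exists_powerBasis_adjoin_cubeRoot hcube (hθ n)
    have hsep := isSeparable_adjoin_cubeRoot h3' hcube (hθ n)
    have hff : FunctionField F (IntermediateField.adjoin (RatFunc F) {θ n}) := pb.finite
    have hfin : Module.finrank (RatFunc F) (IntermediateField.adjoin (RatFunc F) {θ n}) = 3 := by
      rw [pb.finrank, pb.dim_eq_three hmin]
    -- Here `c = H`: `GH² - H³ = (G - H)H²`.
    have hA : P ∣ p (2 * n) * p (2 * n + 1) ^ 2 - p (2 * n + 1) ^ 3 := by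
      rw [show p (2 * n) * p (2 * n + 1) ^ 2 - p (2 * n + 1) ^ 3 =
        (p (2 * n) - p (2 * n + 1)) * p (2 * n + 1) ^ 2 by ring]
      exact (hcongr _ _).mul_right _
    obtain ⟨η, 𝔭, hmax, hover, hmem⟩ := exists_maximal_liesOver_quadratic_mem pb hmin hP hA
      fun h => (hP.prime.dvd_or_dvd h).elim h3P (hPp _)
    refine ⟨hfin, ⟨p (2 * n), p (2 * n + 1), θ n, (hp _).2.1, (hp _).2.1, hinj.ne (by omega),
      (hp _).2.2, (hp _).2.2, hcongr _ _, ?_, rfl⟩, ?_, ⟨𝔭, hmax.isPrime, hover, ?_⟩, ?_⟩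
    · rw [hθ n, ← IsScalarTower.algebraMap_apply]
    · exact isCoprime_functionFieldDiscr h3 pb hmin
        (((hp _).2.1.coprime_iff_not_dvd.2 (hp _).2.2).mul_left
          ((hp _).2.1.coprime_iff_not_dvd.2 (hp _).2.2).pow_left)
    · refine inertiaDeg_eq_two_of_quadratic_mem hq hP hPodd (hPp _) ?_ hmem
      rw [natCard_ringOfIntegers_quotient_span hP.ne_zero, hfin]
    · exact not_isCarmichaelIn_of_quadratic_mem hq hfin hdeg hP hPg (hPp _) hmem
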